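/- Let $G=(V,E)$ be a finite planar graph (loops and multiple edges allowed, not necessarily connected) embedded in the plane, let $\beta\ge 0$, let $(J_e)_{e\in E}$ be arbitrary nonnegative coupling constants, and put $x_e=\tanh(\beta J_e)\in[0,1)$. Let $C_G$ be the weighted bipartite graph obtained from $G$ as follows. Each edge $e$ of $G$ is replaced by a quadrangle, whose four vertices lie near the two ends of $e$, on the two sides of $e$. The four sides of the quadrangle are called streets. The two streets running parallel to $e$, one on each side of $e$, correspond to the edge $e$ and have weight $\frac{2x_e}{1+x_e^2}$. The two streets crossing $e$, one near each end of $e$, are parallel to the dual edge $e^*$, correspond to the edge $e^*$ of the dual graph $G^*$, and have weight $\frac{1-x_e^2}{1+x_e^2}$. Finally, each corner of $G$ between two consecutive edges (or edge ends) at a vertex gives an edge of weight $1$, called a road, which connects the two neighbouring vertices of the corresponding quadrangles. Let $\mathbf P^{\emptyset}_{C_G}$ be the probability measure on dimer covers (perfect matchings) $M$ of $C_G$ that is proportional to the product of the weights of the edges in $M$. Then: 1. $\mathbf P^{\emptyset}_{C_G}(a\in M)=\frac12$ for every road $a$ of $C_G$. 2. $\mathbf P^{\emptyset}_{C_G}(a\in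 M)=\mathbf P^{\emptyset}_{C_G}(a'\in M)$ if $a$ and $a'$ are the two parallel streets corresponding to the same edge of $G$, or to the same edge of $G^*$. 3. If $a$ is a street corresponding to the edge $e=\{v,v'\}$ of $G$, then $$\mathbf P^{\emptyset}_{C_G}(a\in M)=\frac{x_e}{1+x_e^2}\,\mu_G[\sigma_v\sigma_{v'}],$$ where $\mu_G$ is the Ising measure on $G$ with free boundary conditions, proportional to $\exp\big(\sum_{\{v,v'\}\in E}\beta J_{\{v,v'\}}\sigma_v\sigma_{v'}\big)$. If moreover $\beta J_f>0$ for all $f\in E$, and $a$ is a street corresponding to the dual edge $e^*=\{u,u'\}$ of $e$, then $$\mathbf P^{\emptyset}_{C_G}(a\in M)=\frac{1-x_e^2}{2(1+x_e^2)}\,\mu_{G^*}[\sigma_u\sigma_{u'}],$$ where $\mu_{G^*}$ is the Ising measure on the dual graph $G^*$, whose coupling constants $J^*_{f^*}$ (including the inverse temperature) are given by $\tanh J^*_{f^*}=\frac{1-x_f}{1+x_f}$. (If $G$ is disconnected, $G^*$ may be taken to be the disjoint union of the duals of the components of $G$; this does not change these two-point functions.) -/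

import Mathlib

/-! ## Weighted dimer models on finite multigraphs -/

section Dimer

variable {W A : Type*} [Fintype A]

/-- A dimer cover (perfect matching) of the multigraph with vertex type `W`, edge type `A` and
endpoints `ends`: a set of edges such that every vertex is incident to exactly one of them. -/
def IsDimerCover (ends : A → Sym2 W) (M : Finset A) : Prop :=
  ∀ w : W, ∃! a : A, a ∈ M ∧ w ∈ ends a

open Classical in
/-- The finite set of all dimer covers. -/
noncomputable def dimerCovers (ends : A → Sym2 W) : Finset (Finset A) :=
  Finset.univ.filter (fun M => IsDimerCover ends M)

/-- The partition function of the dimer model with edge weights `wt`. -/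
noncomputable def dimerZ (ends : A → Sym2 W) (wt : A → ℝ) : ℝ :=
  ∑ M ∈ dimerCovers ends, ∏ a ∈ M, wt a

open Classical in
/-- The probability that the edge `a` belongs to the random dimer cover, a cover being chosen with
probability proportional to the product of its edge weights. -/
noncomputable def dimerProb (ends : A → Sym2 W) (wt : A → ℝ) (a : A) : ℝ :=
  (∑ M ∈ (dimerCovers ends).filter (fun M => a ∈ M), ∏ a' ∈ M, wt a') / dimerZ ends wt

end Dimer

/-! ## The Ising model on finite multigraphs -/

section Ising

variable {V E : Type*} [Fintype E]

/-- The Boltzmann weight of a spin configuration `s` for the Ising model on the multigraph whose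
edge `e` has the endpoints `tail (e, false)` and `tail (e, true)` and coupling constant `K e`
(the inverse temperature is included in `K`). -/
noncomputable def isingWeight (tail : E × Bool → V) (K : E → ℝ) (s : V → ℤˣ) : ℝ :=
  Real.exp (∑ e, K e * (((s (tail (e, false)) : ℤ) : ℝ) * ((s (tail (e, true)) : ℤ) : ℝ)))

open Classical in
/-- The two-point function `μ[σ_a σ_b]` of the Ising model (with free boundary conditions). -/
noncomputable def isingTwoPoint [Fintype V] (tail : E × Bool → V) (K : E → ℝ) (a b : V) : ℝ :=
  (∑ s : V → ℤˣ, ((s a : ℤ) : ℝ) * ((s b : ℤ) : ℝ) * isingWeight tail K s) /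
    ∑ s : V → ℤˣ, isingWeight tail K s

end Ising

/-! ## Plane graphs as combinatorial maps -/

/-- A finite multigraph (loops and multiple edges are allowed) with vertices `V` and edges `E`,
cellularly embedded (each component separately) in an oriented closed surface. The embedding is
given by its rotation system. The two directed edges (darts) over the edge `e` are `(e, false)` and
`(e, true)`; `tail d` is the initial vertex of the dart `d`, and `rot d` is the dart that follows
`d` in the counterclockwise order around `tail d`. Thus the darts issued from a common vertex form
one cycle of `rot`. -/
structure EmbeddedGraph (V E : Type*) where
  tail : E × Bool → V
  rot : Equiv.Perm (E × Bool)
  tail_eq_iff : ∀ d d' : E × Bool, tail d = tail d' ↔ rot.SameCycle d d'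

/-- Reversal of darts. -/
def dartRev (E : Type*) : Equiv.Perm (E × Bool) where
  toFun d := (d.1, !d.2)
  invFun d := (d.1, !d.2)
  left_inv d := by simp
  right_inv d := by simp

namespace EmbeddedGraph

variable {V E : Type*}

/-- The face permutation: `faceNext d` follows `d` on the boundary of the face to the left of `d`.
At the end vertex of `d`, it is the dart preceding the reversal of `d` in the counterclockwise
order. -/
def faceNext (G : EmbeddedGraph V E) : Equiv.Perm (E × Bool) := G.rot⁻¹ * dartRev E

/-- The faces of the embedded graph, i.e. the orbits of darts under the face permutation. -/
def Face (G : EmbeddedGraph V E) : Type _ := Quotient (Equiv.Perm.SameCycle.setoid G.faceNext)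

/-- The face to the left of a dart. Seen as a map from darts to vertices of the dual graph, it
describes the dual multigraph `G*`: the dual of the edge `e` joins the faces on its two sides. -/
def leftFace (G : EmbeddedGraph V E) (d : E × Bool) : G.Face :=
  Quotient.mk (Equiv.Perm.SameCycle.setoid G.faceNext) d

noncomputable instance [Finite E] (G : EmbeddedGraph V E) : Fintype G.Face :=
  haveI : Finite G.Face :=
    inferInstanceAs (Finite (Quotient (Equiv.Perm.SameCycle.setoid G.faceNext)))
  Fintype.ofFinite _

/-- Planarity, as the Euler relation `|V| - |E| + |F| = 2 |C|`, where `C` is the set of connected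
components (isolated vertices, which carry no darts, are counted neither in `V` nor in `C`, and the
faces are counted separately in each component). Since a component of genus `g` contributes
`2 - 2 g` to the left-hand side, the relation holds if and only if every component is embedded in
the sphere. -/
def IsPlanar (G : EmbeddedGraph V E) : Prop :=
  Nat.card (Quotient (Equiv.Perm.SameCycle.setoid G.rot)) + Nat.card G.Face =
    Nat.card E + 2 * Nat.card (MulAction.orbitRel.Quotient
      (Subgroup.closure ({G.rot, dartRev E} : Set (Equiv.Perm (E × Bool)))) (E × Bool))

end EmbeddedGraph

/-! ## The bipartite dimer graph `C_G` -/

/-- Every edge `e` of `G` is replaced by a quadrangle. Its four vertices lie next to the two ends of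
`e`, on the left and on the right of `e`. For a dart `d` over `e`, `white d` is the vertex near the
tail of `d` on the left of `d`, and `black d` is the one near the tail of `d` on the right of `d`. -/
inductive CGVertex (E : Type*) where
  | white (d : E × Bool)
  | black (d : E × Bool)

/-- The edges of `C_G`.
* `road d` corresponds to the corner of `G` at the vertex `tail d` between the darts `d` and
  `rot d`, which lies in the face to the left of `d`.
* `primalStreet d` is the side of the quadrangle that runs parallel to `d`, on its left.
  Both `primalStreet (e, false)` and `primalStreet (e, true)` correspond to the edge `e` of `G`.
* `dualStreet d` is the side of the quadrangle that crosses `d` near its tail. Both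
  `dualStreet (e, false)` and `dualStreet (e, true)` are parallel to the dual edge of `e`, and
  correspond to that edge of `G*`. -/
inductive CGEdge (E : Type*) where
  | road (d : E × Bool)
  | primalStreet (d : E × Bool)
  | dualStreet (d : E × Bool)
  deriving DecidableEq, Fintype

/-- The endpoints of the edges of `C_G`. A road joins the quadrangles of two edges of `G` that are
consecutive around a vertex (if that vertex has degree one, then the road is parallel to
a street). -/
def EmbeddedGraph.cgEnds {V E : Type*} (G : EmbeddedGraph V E) : CGEdge E → Sym2 (CGVertex E)
  | .road d => s(.white d, .black (G.rot d))
  | .primalStreet d => s(.white d, .black (dartRev E d))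
  | .dualStreet d => s(.white d, .black d)

/-- The edge weights of `C_G`, where `x e` is the high-temperature Ising weight of the edge `e`. -/
noncomputable def cgWeight {E : Type*} (x : E → ℝ) : CGEdge E → ℝ
  | .road _ => 1
  | .primalStreet d => 2 * x d.1 / (1 + x d.1 ^ 2)
  | .dualStreet d => (1 - x d.1 ^ 2) / (1 + x d.1 ^ 2)

/-- The probability of the edge `a` of `C_G` being in the dimer cover, for the weights that come
from the Ising model on `G` with inverse temperature `β` and coupling constants `J`. -/
noncomputable def EmbeddedGraph.cgProb {V E : Type*} [Fintype E]
    (G : EmbeddedGraph V E) (β : ℝ) (J : E → ℝ) (a : CGEdge E) : ℝ :=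
  dimerProb G.cgEnds (cgWeight (fun e => Real.tanh (β * J e))) a

/-- The Kramers-Wannier dual of the coupling `K > 0`, defined by `tanh K* = (1 - x) / (1 + x)` with
`x = tanh K`. -/
noncomputable def dualCoupling (K : ℝ) : ℝ :=
  Real.artanh ((1 - Real.tanh K) / (1 + Real.tanh K))

/-! ## Binary chains on an embedded graph -/

/-! Once the occupied roads are fixed, the streets decouple quadrangle by quadrangle
(`dimerZ_eq_sum_roads`). A quadrangle contributes a local weight that vanishes unless an even number
of its four corner roads are occupied. Put s = 2x/(1+x²) and c = (1-x²)/(1+x²). Since s² + c² = 1,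
four empty corners (two matchings by streets) weigh as much as four occupied ones (no street). All
local weights are therefore invariant under complementing the set of roads, which gives roads
probability 1/2.

On a plane graph, an even road configuration is a vertex spin plus a face spin
(`exists_vertex_face_of_even`). Planarity enters here, Euler's relation being exactness mod 2.
Kramers-Wannier duality (`exists_pos_sum_faces`) turns the face spins into a second family s' of
vertex spins next to the first family s. By `isingQuadWeight_expansion` the joint weight is a
product of Ising weights of s' and of s' + s, so the dimer partition function is a constant times
the square of the Ising one.

The probability of an edge is the relative loss of partition function when its weight is set to 0.
For a primal street, symmetrizing this loss under complementation forgets on which side of e the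
street lies. It inserts s times the average, over the two Ising copies, of the spin product along e,
so the probability is (s/2) μ[σσ']. At a white vertex the road and the two streets exhaust all
cases, so the two street probabilities add up to 1/2. The dual formula is then the relation
`isingTwoPoint_dual` between nearest-neighbour correlations. -/

/-- The function on edges whose value at an edge is the sum of the values at its two darts. -/
def edgeSum (E : Type*) : (E × Bool → ZMod 2) →ₗ[ZMod 2] (E → ZMod 2) :=
  LinearMap.funLeft (ZMod 2) (ZMod 2) (fun e => (e, false)) +
    LinearMap.funLeft (ZMod 2) (ZMod 2) (fun e => (e, true))

theorem edgeSum_apply {E : Type*} (f : E × Bool → ZMod 2) (e : E) :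
    edgeSum E f e = f (e, false) + f (e, true) := rfl

theorem zmod_two_add_eq_zero {a b : ZMod 2} : a + b = 0 ↔ a = b := by
  revert a b; decide

theorem zmod_two_add_comm_of_add_eq {a b a' b' : ZMod 2} (h : b + b' = a + a') :
    a + b = a' + b' := by
  revert a b a' b'; decide

theorem edgeSum_eq_zero_iff {E : Type*} (f : E × Bool → ZMod 2) :
    edgeSum E f = 0 ↔ ∀ d, f (dartRev E d) = f d := by
  constructor
  · rintro h ⟨e, k⟩
    have he := zmod_two_add_eq_zero.1 (congrFun h e)
    cases k
    · exact he.symm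
    · exact he
  · intro h
    funext e
    exact zmod_two_add_eq_zero.2 (h (e, true))

/-- The coboundary of functions on the cycles of a permutation of the darts. -/
def cycleCoboundary {E : Type*} (p : Equiv.Perm (E × Bool)) :
    (Quotient (Equiv.Perm.SameCycle.setoid p) → ZMod 2) →ₗ[ZMod 2] (E → ZMod 2) :=
  edgeSum E ∘ₗ LinearMap.funLeft (ZMod 2) (ZMod 2) (Quotient.mk _)

theorem invariant_of_mem_closure {D α : Type*} {S : Set (Equiv.Perm D)} {f : D → α}
    (h : ∀ g ∈ S, ∀ d, f (g d) = f d) {g : Equiv.Perm D} (hg : g ∈ Subgroup.closure S) (d : D) :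
    f (g d) = f d := by
  induction hg using Subgroup.closure_induction generalizing d with
  | mem g hg => exact h g hg d
  | one => rfl
  | mul a b _ _ ha hb => rw [Equiv.Perm.mul_apply, ha, hb]
  | inv a _ ha => simpa using (ha (a⁻¹ d)).symm

/-- A function on the cycles of `p` has zero coboundary exactly when it is also invariant under dart
reversal, that is, when it is pulled back along `proj` from the connected components. -/
theorem finrank_ker_cycleCoboundary {E : Type*} [Finite E] (p : Equiv.Perm (E × Bool)) :
    Module.finrank (ZMod 2) (LinearMap.ker (cycleCoboundary p)) =
      Nat.card (MulAction.orbitRel.Quotient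
        (Subgroup.closure ({p, dartRev E} : Set (Equiv.Perm (E × Bool)))) (E × Bool)) := by
  classical
  set H := Subgroup.closure ({p, dartRev E} : Set (Equiv.Perm (E × Bool))) with hH
  have hp : p ∈ H := Subgroup.subset_closure (by simp)
  have hr : dartRev E ∈ H := Subgroup.subset_closure (by simp)
  let proj : Quotient (Equiv.Perm.SameCycle.setoid p) → MulAction.orbitRel.Quotient H (E × Bool) :=
    Quotient.lift (fun d => (Quotient.mk (MulAction.orbitRel H (E × Bool)) d)) (by
      rintro a b ⟨i, rfl⟩
      refine (Quotient.sound ?_).symm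
      exact ⟨⟨p ^ i, H.zpow_mem hp i⟩, rfl⟩)
  have hproj : Function.Surjective proj := by
    intro q
    induction q using Quotient.inductionOn with
    | h d => exact ⟨Quotient.mk _ d, rfl⟩
  have hker : LinearMap.ker (cycleCoboundary p) =
      LinearMap.range (LinearMap.funLeft (ZMod 2) (ZMod 2) proj) := by
    ext f
    rw [LinearMap.mem_ker, cycleCoboundary, LinearMap.comp_apply, edgeSum_eq_zero_iff,
      LinearMap.mem_range]
    constructor
    · intro h
      refine ⟨Quotient.lift (fun d => f (Quotient.mk _ d)) ?_, ?_⟩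
      · rintro a b ⟨⟨g, hg⟩, rfl⟩
        refine invariant_of_mem_closure (f := fun d => f (Quotient.mk _ d)) ?_ hg b
        intro g hg d
        rcases hg with rfl | rfl
        · congr 1
          exact Quotient.sound (Equiv.Perm.sameCycle_apply_left.2 (Equiv.Perm.SameCycle.refl _ _))
        · exact h d
      · funext q
        induction q using Quotient.inductionOn with
        | h d => rfl
    · rintro ⟨g, rfl⟩ d
      change g (Quotient.mk _ _) = g (Quotient.mk _ _)
      congr 1
      exact Quotient.sound ⟨⟨dartRev E, hr⟩, rfl⟩
  have : Finite (MulAction.orbitRel.Quotient H (E × Bool)) :=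
    inferInstanceAs (Finite (Quotient _))
  have := Fintype.ofFinite (MulAction.orbitRel.Quotient H (E × Bool))
  rw [hker, LinearMap.finrank_range_of_inj (LinearMap.funLeft_injective_of_surjective _ _ _ hproj),
    Module.finrank_fintype_fun_eq_card, Nat.card_eq_fintype_card]

theorem finrank_range_cycleCoboundary {E : Type*} [Finite E] (p : Equiv.Perm (E × Bool)) :
    Module.finrank (ZMod 2) (LinearMap.range (cycleCoboundary p)) +
      Nat.card (MulAction.orbitRel.Quotient
        (Subgroup.closure ({p, dartRev E} : Set (Equiv.Perm (E × Bool)))) (E × Bool)) =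
      Nat.card (Quotient (Equiv.Perm.SameCycle.setoid p)) := by
  have := Fintype.ofFinite (Quotient (Equiv.Perm.SameCycle.setoid p))
  rw [← finrank_ker_cycleCoboundary, LinearMap.finrank_range_add_finrank_ker,
    Module.finrank_fintype_fun_eq_card, Nat.card_eq_fintype_card]

/-! ### Planarity as exactness mod 2 -/

namespace EmbeddedGraph

variable {V E : Type*} (G : EmbeddedGraph V E)

theorem faceNext_dartRev (d : E × Bool) : G.faceNext (dartRev E d) = G.rot⁻¹ d := by
  simp [faceNext, dartRev]

theorem closure_faceNext :
    Subgroup.closure ({G.faceNext, dartRev E} : Set (Equiv.Perm (E × Bool))) =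
      Subgroup.closure {G.rot, dartRev E} := by
  have hrev : dartRev E * dartRev E = 1 := by ext d <;> simp [dartRev]
  apply le_antisymm
  · rw [Subgroup.closure_le]
    rintro g (rfl | rfl)
    · exact mul_mem (inv_mem (Subgroup.subset_closure (by simp)))
        (Subgroup.subset_closure (by simp))
    · exact Subgroup.subset_closure (by simp)
  · rw [Subgroup.closure_le]
    rintro g (rfl | rfl)
    · have h : (G.faceNext * dartRev E)⁻¹ = G.rot := by
        rw [faceNext, mul_assoc, hrev, mul_one, inv_inv]
      rw [← h]
      exact inv_mem (mul_mem (Subgroup.subset_closure (by simp))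
        (Subgroup.subset_closure (by simp)))
    · exact Subgroup.subset_closure (by simp)

/-- The face to the right of a dart is to the left of the dart preceding it around its tail. -/
theorem leftFace_dartRev (d : E × Bool) : G.leftFace (dartRev E d) = G.leftFace (G.rot⁻¹ d) := by
  rw [← faceNext_dartRev]
  exact Quotient.sound (Equiv.Perm.sameCycle_apply_right.2 (Equiv.Perm.SameCycle.refl _ _))

theorem tail_rot (d : E × Bool) : G.tail (G.rot d) = G.tail d :=
  (G.tail_eq_iff _ _).2 (Equiv.Perm.sameCycle_apply_left.2 (Equiv.Perm.SameCycle.refl _ _))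

theorem tail_rot_inv (d : E × Bool) : G.tail (G.rot⁻¹ d) = G.tail d := by
  simpa using (G.tail_rot (G.rot⁻¹ d)).symm

/-- The pairing is the sum over darts of `f d * (g d + g (G.rot⁻¹ d))`. As `f` is constant around
vertices, reindexing by `rot` makes the two halves equal, and they cancel mod 2. -/
theorem dotProduct_edgeSum_eq_zero [Fintype E] {f g : E × Bool → ZMod 2}
    (hf : ∀ d, f (G.rot d) = f d) (hg : ∀ d, g (dartRev E d) = g (G.rot⁻¹ d)) :
    edgeSum E f ⬝ᵥ edgeSum E g = 0 := by
  have h1 : edgeSum E f ⬝ᵥ edgeSum E g = ∑ d, f d * (g d + g (dartRev E d)) := by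
    rw [Fintype.sum_prod_type, dotProduct]
    refine Finset.sum_congr rfl fun e _ => ?_
    rw [Fintype.sum_bool]
    simp only [edgeSum_apply, dartRev, Equiv.coe_fn_mk, Bool.not_true, Bool.not_false]
    ring
  have h2 : ∑ d, f d * g (G.rot⁻¹ d) = ∑ d, f d * g d := by
    rw [← Equiv.sum_comp G.rot]
    simp [hf]
  simp only [h1, hg, mul_add, Finset.sum_add_distrib, h2]
  exact CharTwo.add_self_eq_zero _

/-- On a plane graph, the binary functions on edges that are orthogonal to all coboundaries are the
coboundaries of the dual graph. -/
theorem exists_face_of_orthogonal [Fintype E] (hG : G.IsPlanar) (w : E → ZMod 2)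
    (hw : ∀ s : V → ZMod 2, w ⬝ᵥ edgeSum E (s ∘ G.tail) = 0) :
    ∃ t : G.Face → ZMod 2, edgeSum E (t ∘ G.leftFace) = w := by
  classical
  let B : LinearMap.BilinForm (ZMod 2) (E → ZMod 2) := dotProductBilin (ZMod 2) (ZMod 2)
  have hB : B.Nondegenerate := by
    refine ⟨fun v h => dotProduct_eq_zero v h, fun v h => dotProduct_eq_zero v fun u => ?_⟩
    rw [dotProduct_comm]
    exact h u
  have hle : LinearMap.range (cycleCoboundary G.faceNext) ≤
      B.orthogonal (LinearMap.range (cycleCoboundary G.rot)) := by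
    rintro _ ⟨g, rfl⟩ _ ⟨f, rfl⟩
    refine G.dotProduct_edgeSum_eq_zero (fun d => congrArg f ?_)
      (fun d => congrArg g (G.leftFace_dartRev d))
    exact Quotient.sound (Equiv.Perm.sameCycle_apply_left.2 (Equiv.Perm.SameCycle.refl _ _))
  -- With C components, the two ranks are V - C and F - C; by Euler's relation they sum to E, so the
  -- inclusion is an equality.
  have hfin : LinearMap.range (cycleCoboundary G.faceNext) =
      B.orthogonal (LinearMap.range (cycleCoboundary G.rot)) := by
    apply Submodule.eq_of_le_of_finrank_le hle
    have h1 := finrank_range_cycleCoboundary G.rot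
    have h2 := finrank_range_cycleCoboundary G.faceNext
    have h3 := LinearMap.BilinForm.finrank_orthogonal hB
      (LinearMap.range (cycleCoboundary G.rot))
    rw [closure_faceNext] at h2
    rw [Module.finrank_fintype_fun_eq_card, ← Nat.card_eq_fintype_card] at h3
    unfold IsPlanar Face at hG
    omega
  have hmem : w ∈ B.orthogonal (LinearMap.range (cycleCoboundary G.rot)) := by
    rintro _ ⟨f, rfl⟩
    -- Isolated vertices carry no dart; the value 0 there is arbitrary.
    have h := hw fun v => if h : ∃ d, G.tail d = v then f (Quotient.mk _ h.choose) else 0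
    rw [dotProduct_comm] at h
    refine Eq.trans ?_ h
    change edgeSum E (fun d => f (Quotient.mk _ d)) ⬝ᵥ w = _
    congr 2
    funext d
    have hd : ∃ d', G.tail d' = G.tail d := ⟨d, rfl⟩
    simp only [Function.comp_apply, dif_pos hd]
    congr 1
    exact (Quotient.sound ((G.tail_eq_iff _ _).1 hd.choose_spec)).symm
  rw [← hfin] at hmem
  exact hmem

theorem dotProduct_coboundary_dual [Fintype E] (s : V → ZMod 2) (t : G.Face → ZMod 2) :
    edgeSum E (t ∘ G.leftFace) ⬝ᵥ edgeSum E (s ∘ G.tail) = 0 := by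
  rw [dotProduct_comm]
  exact G.dotProduct_edgeSum_eq_zero (fun d => congrArg s (G.tail_rot d))
    (fun d => congrArg t (G.leftFace_dartRev d))

/-- On a plane graph, a binary function on the corners whose sum over the four corners at every
edge vanishes is the sum of a function of the vertices and a function of the faces. -/
theorem exists_vertex_face_of_even [Fintype E] (hG : G.IsPlanar) (r : E × Bool → ZMod 2)
    (hr : edgeSum E (fun d => r d + r (G.rot⁻¹ d)) = 0) :
    ∃ (s : V → ZMod 2) (t : G.Face → ZMod 2), ∀ d, r d = s (G.tail d) + t (G.leftFace d) := by
  classical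
  have hrev := (edgeSum_eq_zero_iff _).1 hr
  -- By evenness, the jump of `r` between the two sides of an edge is the same at both ends, hence a
  -- function of the edge. Around a vertex the jumps telescope, so it is orthogonal to vertex
  -- coboundaries.
  obtain ⟨t, ht⟩ := G.exists_face_of_orthogonal hG
    (fun e => r (e, false) + r (G.rot⁻¹ (e, false))) (by
      intro s
      have h2 : ∑ d, s (G.tail d) * r (G.rot⁻¹ d) = ∑ d, s (G.tail d) * r d := by
        rw [← Equiv.sum_comp G.rot]
        simp [G.tail_rot]
      have h3 : (fun e => r (e, false) + r (G.rot⁻¹ (e, false))) ⬝ᵥ edgeSum E (s ∘ G.tail) =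
          ∑ d, s (G.tail d) * (r d + r (G.rot⁻¹ d)) := by
        rw [Fintype.sum_prod_type, dotProduct]
        refine Finset.sum_congr rfl fun e _ => ?_
        have he : r (e, true) + r (G.rot⁻¹ (e, true)) = r (e, false) + r (G.rot⁻¹ (e, false)) :=
          hrev (e, false)
        rw [Fintype.sum_bool, he, edgeSum_apply]
        simp only [Function.comp_apply]
        ring
      simp only [h3, mul_add, Finset.sum_add_distrib, h2]
      exact CharTwo.add_self_eq_zero _)
  have hd : ∀ d, t (G.leftFace d) + t (G.leftFace (G.rot⁻¹ d)) = r d + r (G.rot⁻¹ d) := by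
    rintro ⟨e, k⟩
    have he := congrFun ht e
    rw [edgeSum_apply] at he
    have hk : t (G.leftFace (e, k)) + t (G.leftFace (dartRev E (e, k))) =
        r (e, false) + r (G.rot⁻¹ (e, false)) := by
      cases k
      · exact he
      · rw [add_comm]
        exact he
    rw [← leftFace_dartRev, hk]
    cases k
    · rfl
    · exact hrev (e, true)
  -- Removing the face part `t` from `r` leaves a function that does not jump around a vertex.
  have hinv : ∀ d, r (G.rot d) + t (G.leftFace (G.rot d)) = r d + t (G.leftFace d) := by
    intro d
    have h := hd (G.rot d)
    simp only [Equiv.Perm.inv_def, Equiv.symm_apply_apply] at h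
    exact zmod_two_add_comm_of_add_eq h
  have hcyc : ∀ d d', G.tail d = G.tail d' →
      r d + t (G.leftFace d) = r d' + t (G.leftFace d') := by
    intro d d' h
    obtain ⟨i, rfl⟩ := (G.tail_eq_iff _ _).1 h
    have hi : G.rot ^ i ∈ Subgroup.closure {G.rot} :=
      Subgroup.zpow_mem _ (Subgroup.subset_closure (Set.mem_singleton _)) i
    refine (invariant_of_mem_closure (f := fun d => r d + t (G.leftFace d)) ?_ hi d).symm
    intro g hg d
    rw [Set.mem_singleton_iff.1 hg]
    exact hinv d
  refine ⟨fun v => if h : ∃ d, G.tail d = v then r h.choose + t (G.leftFace h.choose) else 0,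
    t, fun d => ?_⟩
  have h : ∃ d', G.tail d' = G.tail d := ⟨d, rfl⟩
  dsimp only
  rw [dif_pos h, hcyc _ _ h.choose_spec, add_assoc, CharTwo.add_self_eq_zero, add_zero]

end EmbeddedGraph

/-! ## Kramers-Wannier duality -/

/-- The nontrivial sign character of `ZMod 2`. -/
noncomputable def binarySign (a : ZMod 2) : ℝ := if a = 0 then 1 else -1

theorem zmod_two_cases (a : ZMod 2) : a = 0 ∨ a = 1 := by
  revert a; decide

@[simp] theorem binarySign_zero : binarySign 0 = 1 := if_pos rfl

@[simp] theorem binarySign_one : binarySign 1 = -1 := if_neg one_ne_zero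

theorem binarySign_add (a b : ZMod 2) : binarySign (a + b) = binarySign a * binarySign b := by
  have h : (1 : ZMod 2) + 1 = 0 := rfl
  rcases zmod_two_cases a with rfl | rfl <;> rcases zmod_two_cases b with rfl | rfl <;> simp [h]

theorem binarySign_sum {ι : Type*} (s : Finset ι) (f : ι → ZMod 2) :
    binarySign (∑ i ∈ s, f i) = ∏ i ∈ s, binarySign (f i) := by
  classical
  induction s using Finset.induction_on with
  | empty => simp
  | insert a s ha ih => rw [Finset.sum_insert ha, Finset.prod_insert ha, binarySign_add, ih]

-- Translating by an element where `f` equals 1 negates the sum of a nontrivial character.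
open Classical in
theorem sum_binarySign {A : Type*} [AddCommGroup A] [Fintype A] (f : A →+ ZMod 2) :
    ∑ a, binarySign (f a) = if ∀ a, f a = 0 then (Fintype.card A : ℝ) else 0 := by
  split_ifs with h
  · simp [h]
  · push Not at h
    obtain ⟨b, hb⟩ := h
    have hb1 := (zmod_two_cases (f b)).resolve_left hb
    have h1 : ∑ a, binarySign (f (a + b)) = ∑ a, binarySign (f a) :=
      Equiv.sum_comp (Equiv.addRight b) fun a => binarySign (f a)
    simp only [map_add, binarySign_add, hb1, binarySign_one, mul_neg, mul_one,
      Finset.sum_neg_distrib] at h1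
    linarith

open Classical in
/-- Summing over the domain of a homomorphism amounts to summing over its range. -/
theorem exists_pos_sum_comp_hom {A B : Type*} [AddGroup A] [AddGroup B] [Fintype A] [Fintype B]
    (f : A →+ B) : ∃ c : ℝ, 0 < c ∧ ∀ F : B → ℝ,
      ∑ a, F (f a) = c * ∑ b, if b ∈ Set.range f then F b else 0 := by
  -- The constant is the size of the kernel, common to all nonempty fibres.
  refine ⟨(Finset.univ.filter fun a => f a = 0).card, ?_, fun F => ?_⟩
  · exact_mod_cast Finset.card_pos.2 ⟨0, by simp⟩
  · rw [← Finset.sum_fiberwise (s := Finset.univ) (g := f), Finset.mul_sum]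
    refine Finset.sum_congr rfl fun b _ => ?_
    rw [Finset.sum_congr rfl (g := fun _ => F b) (by simp +contextual), Finset.sum_const,
      nsmul_eq_mul]
    split_ifs with h
    · rw [AddMonoidHom.card_fiber_eq_of_mem_range f h ⟨0, map_zero f⟩]
    · rw [Finset.filter_false_of_mem fun a _ ha => h ⟨a, ha⟩]
      simp

open Classical in
/-- High-temperature expansion of a product over the edges. -/
theorem prod_add_binarySign_mul {E : Type*} [Fintype E] (g : E → ZMod 2 → ℝ)
    (u : E → ZMod 2) :
    ∏ e, (g e 0 + binarySign (u e) * g e 1) =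
      ∑ w : E → ZMod 2, binarySign (w ⬝ᵥ u) * ∏ e, g e (w e) := by
  have h : ∀ e, g e 0 + binarySign (u e) * g e 1 =
      ∑ a : ZMod 2, binarySign (a * u e) * g e a := by
    intro e
    rw [show (Finset.univ : Finset (ZMod 2)) = {0, 1} from rfl, Finset.sum_pair zero_ne_one]
    simp
  simp only [h, Fintype.prod_sum, dotProduct, binarySign_sum, Finset.prod_mul_distrib]

open Classical in
/-- Kramers-Wannier duality for general edge weights. -/
theorem EmbeddedGraph.exists_pos_sum_faces {V E : Type*} [Fintype V] [Fintype E]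
    (G : EmbeddedGraph V E) (hG : G.IsPlanar) :
    ∃ c : ℝ, 0 < c ∧ ∀ g : E → ZMod 2 → ℝ,
      ∑ t : G.Face → ZMod 2, ∏ e, g e (edgeSum E (t ∘ G.leftFace) e) =
        c * ∑ s : V → ZMod 2, ∏ e, (g e 0 + binarySign (edgeSum E (s ∘ G.tail) e) * g e 1) := by
  let f : (G.Face → ZMod 2) →+ (E → ZMod 2) :=
    (edgeSum E ∘ₗ LinearMap.funLeft (ZMod 2) (ZMod 2) G.leftFace).toAddMonoidHom
  obtain ⟨c, hc, hsum⟩ := exists_pos_sum_comp_hom f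
  have hcard : (0 : ℝ) < Fintype.card (V → ZMod 2) := by exact_mod_cast Fintype.card_pos
  refine ⟨c / Fintype.card (V → ZMod 2), by positivity, fun g => ?_⟩
  refine (hsum fun w => ∏ e, g e (w e)).trans ?_
  simp only [prod_add_binarySign_mul]
  rw [Finset.sum_comm, div_mul_eq_mul_div, mul_div_assoc, Finset.sum_div]
  congr 1
  refine Finset.sum_congr rfl fun w _ => ?_
  let φ : (V → ZMod 2) →+ ZMod 2 := AddMonoidHom.mk'
    (fun s => w ⬝ᵥ edgeSum E (LinearMap.funLeft (ZMod 2) (ZMod 2) G.tail s))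
    (fun a b => by rw [map_add, map_add, dotProduct_add])
  have h2 : ∑ s : V → ZMod 2, binarySign (w ⬝ᵥ edgeSum E (s ∘ G.tail)) =
    ∑ s, binarySign (φ s) := rfl
  rw [← Finset.sum_mul, h2, sum_binarySign]
  -- The characters sum to zero unless `w` is orthogonal to all vertex coboundaries; on a plane
  -- graph this means that `w` is a face coboundary.
  have hiff : (∀ s, φ s = 0) ↔ w ∈ Set.range f := by
    constructor
    · intro h
      exact G.exists_face_of_orthogonal hG w h
    · rintro ⟨t, rfl⟩ s
      exact G.dotProduct_coboundary_dual s t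
  by_cases h : w ∈ Set.range f
  · rw [if_pos h, if_pos (hiff.2 h)]
    field_simp
  · rw [if_neg h, if_neg fun h' => h (hiff.1 h')]
    simp

/-! ## The dimer partition function as a vertex model -/

/-- Exactly one of three binary variables is equal to `1`. -/
abbrev ExactlyOne (a b c : ZMod 2) : Prop := a.val + b.val + c.val = 1

open Classical in
/-- The binary indicator function of a finite set. -/
noncomputable def finsetEquivBinary (A : Type*) [Fintype A] : Finset A ≃ (A → ZMod 2) where
  toFun M a := if a ∈ M then 1 else 0
  invFun m := Finset.univ.filter fun a => m a = 1
  left_inv M := by ext a; simp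
  right_inv m := by
    funext a
    rcases zmod_two_cases (m a) with h | h <;> simp [h]

open Classical in
theorem existsUnique_mem_three_iff {A : Type*} [Fintype A] (M : Finset A) {a b c : A}
    (hab : a ≠ b) (hac : a ≠ c) (hbc : b ≠ c) :
    (∃! z, z ∈ M ∧ (z = a ∨ z = b ∨ z = c)) ↔
      ExactlyOne (finsetEquivBinary A M a) (finsetEquivBinary A M b)
        (finsetEquivBinary A M c) := by
  have key : (∃! z, z ∈ M ∧ (z = a ∨ z = b ∨ z = c)) ↔
      (a ∈ M ∧ b ∉ M ∧ c ∉ M) ∨ (a ∉ M ∧ b ∈ M ∧ c ∉ M) ∨ (a ∉ M ∧ b ∉ M ∧ c ∈ M) := by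
    constructor
    · rintro ⟨z, ⟨hz, rfl | rfl | rfl⟩, h⟩
      · exact .inl ⟨hz, fun hb => hab (h b ⟨hb, by simp⟩).symm,
          fun hc => hac (h c ⟨hc, by simp⟩).symm⟩
      · exact .inr (.inl ⟨fun ha => hab (h a ⟨ha, by simp⟩), hz,
          fun hc => hbc (h c ⟨hc, by simp⟩).symm⟩)
      · exact .inr (.inr ⟨fun ha => hac (h a ⟨ha, by simp⟩),
          fun hb => hbc (h b ⟨hb, by simp⟩), hz⟩)
    · rintro (⟨h1, h2, h3⟩ | ⟨h1, h2, h3⟩ | ⟨h1, h2, h3⟩)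
      · refine ⟨a, ⟨h1, by simp⟩, ?_⟩
        rintro y ⟨hy, rfl | rfl | rfl⟩ <;> tauto
      · refine ⟨b, ⟨h2, by simp⟩, ?_⟩
        rintro y ⟨hy, rfl | rfl | rfl⟩ <;> tauto
      · refine ⟨c, ⟨h3, by simp⟩, ?_⟩
        rintro y ⟨hy, rfl | rfl | rfl⟩ <;> tauto
  rw [key]
  have h1 : (1 : ZMod 2).val = 1 := rfl
  by_cases ha : a ∈ M <;> by_cases hb : b ∈ M <;> by_cases hc : c ∈ M <;>
    simp [finsetEquivBinary, ExactlyOne, ha, hb, hc, h1]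

/-- A binary function on the edges of `C_G` consists of its values on the roads and of its values
on the four streets at every edge of `G`. -/
def cgEdgeFunEquiv (E : Type*) :
    (CGEdge E → ZMod 2) ≃ (E × Bool → ZMod 2) × (E → (ZMod 2 × ZMod 2) × (ZMod 2 × ZMod 2)) where
  toFun m := (fun d => m (.road d), fun e =>
    ((m (.primalStreet (e, false)), m (.primalStreet (e, true))),
      (m (.dualStreet (e, false)), m (.dualStreet (e, true)))))
  invFun y a := match a with
    | .road d => y.1 d
    | .primalStreet (e, false) => (y.2 e).1.1
    | .primalStreet (e, true) => (y.2 e).1.2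
    | .dualStreet (e, false) => (y.2 e).2.1
    | .dualStreet (e, true) => (y.2 e).2.2
  left_inv m := by
    funext a
    rcases a with d | ⟨e, _ | _⟩ | ⟨e, _ | _⟩ <;> rfl
  right_inv y := rfl

/-- The edges of `C_G` as a sum type. -/
def cgEdgeEquivSum (E : Type*) : CGEdge E ≃ (E × Bool) ⊕ ((E × Bool) ⊕ (E × Bool)) where
  toFun a := match a with
    | .road d => .inl d
    | .primalStreet d => .inr (.inl d)
    | .dualStreet d => .inr (.inr d)
  invFun y := match y with
    | .inl d => .road d
    | .inr (.inl d) => .primalStreet d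
    | .inr (.inr d) => .dualStreet d
  left_inv a := by cases a <;> rfl
  right_inv y := by rcases y with d | d | d <;> rfl

theorem prod_cgEdge {E : Type*} [Fintype E] (F : CGEdge E → ℝ) :
    ∏ a, F a = (∏ d, F (.road d)) *
      ∏ e, (F (.primalStreet (e, false)) * F (.primalStreet (e, true)) *
        (F (.dualStreet (e, false)) * F (.dualStreet (e, true)))) := by
  rw [← Equiv.prod_comp (cgEdgeEquivSum E).symm, Fintype.prod_sum_type, Fintype.prod_sum_type,
    Fintype.prod_prod_type, Fintype.prod_prod_type, Fintype.prod_prod_type,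
    Fintype.prod_prod_type (f := fun d => F (.road d))]
  simp only [Fintype.prod_bool, ← Finset.prod_mul_distrib, cgEdgeEquivSum, Equiv.coe_fn_symm_mk]
  refine Finset.prod_congr rfl fun e _ => ?_
  ring

/-- The sum of the weights of the configurations of streets in a quadrangle, the occupation numbers
of the roads at its four corners being given. -/
def quadSum (p₀ p₁ q₀ q₁ : ℝ) (a₁ b₁ a₂ b₂ : ZMod 2) : ℝ :=
  ∑ y : (ZMod 2 × ZMod 2) × (ZMod 2 × ZMod 2),
    if ExactlyOne a₁ y.1.1 y.2.1 ∧ ExactlyOne a₂ y.1.2 y.2.2 ∧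
        ExactlyOne b₁ y.1.2 y.2.1 ∧ ExactlyOne b₂ y.1.1 y.2.2 then
      (if y.1.1 = 1 then p₀ else 1) * (if y.1.2 = 1 then p₁ else 1) *
        ((if y.2.1 = 1 then q₀ else 1) * (if y.2.2 = 1 then q₁ else 1))
    else 0

/-- The weights of the vertex model: `x` and `y` tell whether the configuration changes across the
quadrangle in the two directions, and `a` is the occupation number of one of the roads. -/
def quadWeight (p₀ p₁ q₀ q₁ : ℝ) (x y a : ZMod 2) : ℝ :=
  if x = 0 then
    if y = 0 then if a = 0 then q₀ * q₁ + p₀ * p₁ else 1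
    else if a = 0 then p₀ else p₁
  else if y = 0 then if a = 0 then q₀ else q₁ else 0

theorem sum_zmod_two (f : ZMod 2 → ℝ) : ∑ a, f a = f 0 + f 1 := by
  rw [show (Finset.univ : Finset (ZMod 2)) = {0, 1} from rfl, Finset.sum_pair zero_ne_one]

/-- The occupied roads delete corners of a 4-cycle. The weight is 0 if what remains has no matching:
an odd number of vertices, or two of the same colour. -/
theorem quadSum_eq (p₀ p₁ q₀ q₁ : ℝ) (a₁ b₁ a₂ b₂ : ZMod 2) :
    quadSum p₀ p₁ q₀ q₁ a₁ b₁ a₂ b₂ = if a₁ + b₁ + a₂ + b₂ = 0 then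
      quadWeight p₀ p₁ q₀ q₁ (a₁ + b₂) (a₁ + b₁) a₁ else 0 := by
  have h1 : (1 : ZMod 2).val = 1 := rfl
  have h2 : (1 : ZMod 2) + 1 = 0 := rfl
  unfold quadSum quadWeight
  simp only [Fintype.sum_prod_type, sum_zmod_two]
  rcases zmod_two_cases a₁ with rfl | rfl <;> rcases zmod_two_cases b₁ with rfl | rfl <;>
    rcases zmod_two_cases a₂ with rfl | rfl <;> rcases zmod_two_cases b₂ with rfl | rfl <;>
    simp [h1, h2, ExactlyOne, add_comm]

namespace EmbeddedGraph

variable {V E : Type*} (G : EmbeddedGraph V E)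

/-- The configuration `r` of roads has an even number of roads at the four corners of `e`. -/
abbrev EvenAt (r : E × Bool → ZMod 2) (e : E) : Prop :=
  r (e, false) + r (G.rot⁻¹ (e, false)) + r (e, true) + r (G.rot⁻¹ (e, true)) = 0

/-- The local weight at `e` of a configuration of roads in a vertex model. -/
def vertexWeight (w : ZMod 2 → ZMod 2 → ZMod 2 → ℝ) (r : E × Bool → ZMod 2) (e : E) : ℝ :=
  if G.EvenAt r e then
    w (r (e, false) + r (G.rot⁻¹ (e, true))) (r (e, false) + r (G.rot⁻¹ (e, false))) (r (e, false))
  else 0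

theorem isDimerCover_iff [Fintype E] (M : Finset (CGEdge E)) :
    IsDimerCover G.cgEnds M ↔ ∀ e,
      ExactlyOne (finsetEquivBinary _ M (.road (e, false)))
        (finsetEquivBinary _ M (.primalStreet (e, false)))
        (finsetEquivBinary _ M (.dualStreet (e, false))) ∧
      ExactlyOne (finsetEquivBinary _ M (.road (e, true)))
        (finsetEquivBinary _ M (.primalStreet (e, true)))
        (finsetEquivBinary _ M (.dualStreet (e, true))) ∧
      ExactlyOne (finsetEquivBinary _ M (.road (G.rot⁻¹ (e, false))))
        (finsetEquivBinary _ M (.primalStreet (e, true)))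
        (finsetEquivBinary _ M (.dualStreet (e, false))) ∧
      ExactlyOne (finsetEquivBinary _ M (.road (G.rot⁻¹ (e, true))))
        (finsetEquivBinary _ M (.primalStreet (e, false)))
        (finsetEquivBinary _ M (.dualStreet (e, true))) := by
  have hw : ∀ d (a : CGEdge E), CGVertex.white d ∈ G.cgEnds a ↔
      (a = .road d ∨ a = .primalStreet d ∨ a = .dualStreet d) := by
    rintro d (d' | d' | d') <;> simp [cgEnds, eq_comm]
  have hb : ∀ d (a : CGEdge E), CGVertex.black d ∈ G.cgEnds a ↔
      (a = .road (G.rot⁻¹ d) ∨ a = .primalStreet (dartRev E d) ∨ a = .dualStreet d) := by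
    have hrev : ∀ d d' : E × Bool, d = dartRev E d' ↔ d' = dartRev E d := by
      intro d d'
      constructor <;> rintro rfl <;> simp [dartRev]
    have hrot : ∀ d d' : E × Bool, d = G.rot d' ↔ d' = G.rot⁻¹ d := by
      intro d d'
      constructor <;> rintro rfl <;> simp
    rintro d (d' | d' | d')
    · simp [cgEnds, hrot]
    · simp [cgEnds, hrev d]
    · simp [cgEnds, eq_comm]
  have hwhite : ∀ d, (∃! a, a ∈ M ∧ CGVertex.white d ∈ G.cgEnds a) ↔ ExactlyOne
      (finsetEquivBinary _ M (.road d)) (finsetEquivBinary _ M (.primalStreet d))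
      (finsetEquivBinary _ M (.dualStreet d)) := by
    intro d
    simp only [hw]
    exact existsUnique_mem_three_iff M (by simp) (by simp) (by simp)
  have hblack : ∀ d, (∃! a, a ∈ M ∧ CGVertex.black d ∈ G.cgEnds a) ↔ ExactlyOne
      (finsetEquivBinary _ M (.road (G.rot⁻¹ d)))
      (finsetEquivBinary _ M (.primalStreet (dartRev E d)))
      (finsetEquivBinary _ M (.dualStreet d)) := by
    intro d
    simp only [hb]
    exact existsUnique_mem_three_iff M (by simp) (by simp) (by simp)
  constructor
  · intro h e
    exact ⟨(hwhite _).1 (h _), (hwhite _).1 (h _), (hblack (e, false)).1 (h _),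
      (hblack (e, true)).1 (h _)⟩
  · rintro h (⟨e, _ | _⟩ | ⟨e, _ | _⟩)
    · exact (hwhite _).2 (h e).1
    · exact (hwhite _).2 (h e).2.1
    · exact (hblack (e, false)).2 (h e).2.2.1
    · exact (hblack (e, true)).2 (h e).2.2.2

-- Every vertex of `C_G` lies on exactly one quadrangle, so given the roads the matching conditions
-- on streets are independent for different edges of `G`.
open Classical in
theorem dimerZ_eq_sum_roads [Fintype E] (wt : CGEdge E → ℝ) :
    dimerZ G.cgEnds wt = ∑ r : E × Bool → ZMod 2, (∏ d, if r d = 1 then wt (.road d) else 1) *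
      ∏ e, G.vertexWeight (quadWeight (wt (.primalStreet (e, false)))
        (wt (.primalStreet (e, true))) (wt (.dualStreet (e, false)))
        (wt (.dualStreet (e, true)))) r e := by
  have h1 : ∀ M : Finset (CGEdge E), ∏ a ∈ M, wt a =
      ∏ a, if finsetEquivBinary _ M a = 1 then wt a else 1 := by
    intro M
    rw [← Finset.prod_filter]
    congr 1
    exact ((finsetEquivBinary _).symm_apply_apply M).symm
  unfold dimerZ dimerCovers
  rw [Finset.sum_filter]
  simp only [isDimerCover_iff, h1]
  rw [Equiv.sum_comp (finsetEquivBinary (CGEdge E)) (fun m => if ∀ e,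
      ExactlyOne (m (.road (e, false))) (m (.primalStreet (e, false)))
        (m (.dualStreet (e, false))) ∧
      ExactlyOne (m (.road (e, true))) (m (.primalStreet (e, true)))
        (m (.dualStreet (e, true))) ∧
      ExactlyOne (m (.road (G.rot⁻¹ (e, false)))) (m (.primalStreet (e, true)))
        (m (.dualStreet (e, false))) ∧
      ExactlyOne (m (.road (G.rot⁻¹ (e, true)))) (m (.primalStreet (e, false)))
        (m (.dualStreet (e, true))) then ∏ a, if m a = 1 then wt a else 1 else 0),
    ← Equiv.sum_comp (cgEdgeFunEquiv E).symm, Fintype.sum_prod_type]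
  refine Finset.sum_congr rfl fun r _ => ?_
  simp only [vertexWeight, ← quadSum_eq, quadSum, Fintype.prod_sum, Finset.mul_sum]
  refine Finset.sum_congr rfl fun y _ => ?_
  rw [Finset.prod_ite_zero]
  simp only [Finset.mem_univ, forall_true_left, mul_ite, mul_zero, prod_cgEdge]
  rfl

end EmbeddedGraph

/-! ### Edge deletion, complementation and spin representation -/

/-- The probability of an edge in terms of partition functions. -/
theorem dimerProb_eq {W A : Type*} [Fintype A] [DecidableEq A] (ends : A → Sym2 W) (wt : A → ℝ)
    (a : A) :
    dimerProb ends wt a =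
      (dimerZ ends wt - dimerZ ends (Function.update wt a 0)) / dimerZ ends wt := by
  unfold dimerProb
  congr 1
  unfold dimerZ
  rw [← Finset.sum_sub_distrib, Finset.sum_filter]
  refine Finset.sum_congr rfl fun M _ => ?_
  split_ifs with h
  · rw [Finset.prod_eq_zero (f := Function.update wt a 0) h (by simp), sub_zero]
  · rw [Finset.prod_update_of_notMem h, sub_self]

namespace EmbeddedGraph

variable {V E : Type*} (G : EmbeddedGraph V E)

open Classical in
/-- The partition function of a vertex model on the roads. -/
noncomputable def vertexZ [Fintype E] (L : E → ZMod 2 → ZMod 2 → ZMod 2 → ℝ) : ℝ :=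
  ∑ r : E × Bool → ZMod 2, ∏ e, G.vertexWeight (L e) r e

theorem add_one_add_add_one (a b : ZMod 2) : (a + 1) + (b + 1) = a + b := by
  revert a b; decide

theorem vertexWeight_add_one (w : ZMod 2 → ZMod 2 → ZMod 2 → ℝ) (r : E × Bool → ZMod 2) (e : E) :
    G.vertexWeight w (r + 1) e = G.vertexWeight (fun x y a => w x y (a + 1)) r e := by
  have h : ∀ a b c d : ZMod 2, (a + 1) + (b + 1) + (c + 1) + (d + 1) = a + b + c + d := by decide
  unfold vertexWeight EvenAt
  simp only [Pi.add_apply, Pi.one_apply, h]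
  simp only [add_one_add_add_one]

open Classical in
/-- Complementation of the set of roads. -/
theorem vertexZ_add_one [Fintype E] (L : E → ZMod 2 → ZMod 2 → ZMod 2 → ℝ) :
    G.vertexZ (fun e x y a => L e x y (a + 1)) = G.vertexZ L := by
  unfold vertexZ
  rw [← Equiv.sum_comp (Equiv.addRight (1 : E × Bool → ZMod 2))
    fun r => ∏ e, G.vertexWeight (L e) r e]
  simp only [Equiv.coe_addRight, vertexWeight_add_one]

open Classical in
theorem vertexZ_update [Fintype E] (L : E → ZMod 2 → ZMod 2 → ZMod 2 → ℝ) (e₀ : E)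
    (w : ZMod 2 → ZMod 2 → ZMod 2 → ℝ) :
    G.vertexZ (Function.update L e₀ w) = ∑ r : E × Bool → ZMod 2,
      G.vertexWeight w r e₀ * ∏ e ∈ Finset.univ.erase e₀, G.vertexWeight (L e) r e := by
  refine Finset.sum_congr rfl fun r _ => ?_
  rw [← Finset.mul_prod_erase _ _ (Finset.mem_univ e₀), Function.update_self]
  congr 1
  refine Finset.prod_congr rfl fun e he => ?_
  rw [Function.update_of_ne (Finset.ne_of_mem_erase he)]

open Classical in
/-- If all local weights are invariant under complementation, then a modification of the weight at
one edge may be symmetrized. -/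
theorem two_mul_vertexZ_sub_update [Fintype E] (L : E → ZMod 2 → ZMod 2 → ZMod 2 → ℝ)
    (hL : ∀ e x y a, L e x y (a + 1) = L e x y a) (e₀ : E)
    (w u : ZMod 2 → ZMod 2 → ZMod 2 → ℝ)
    (hu : ∀ x y a, L e₀ x y a - w x y a + (L e₀ x y (a + 1) - w x y (a + 1)) = u x y a) :
    2 * (G.vertexZ L - G.vertexZ (Function.update L e₀ w)) =
      G.vertexZ (Function.update L e₀ u) := by
  have h1 : G.vertexZ (Function.update L e₀ w) =
      G.vertexZ (Function.update L e₀ fun x y a => w x y (a + 1)) := by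
    rw [← vertexZ_add_one]
    congr 1
    funext e
    by_cases he : e = e₀
    · subst he
      simp
    · simp only [Function.update_of_ne he, hL]
  have h2 : G.vertexZ L = G.vertexZ (Function.update L e₀ (L e₀)) := by
    rw [Function.update_eq_self]
  -- One of the two copies is complemented: this replaces `w` by its complement and leaves all other
  -- weights unchanged.
  rw [two_mul]
  nth_rewrite 2 [h1]
  rw [h2]
  simp only [vertexZ_update, ← Finset.sum_sub_distrib, ← Finset.sum_add_distrib, ← sub_mul,
    ← add_mul]
  refine Finset.sum_congr rfl fun r _ => ?_
  congr 1
  unfold vertexWeight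
  split_ifs with h
  · rw [← hu, hL]
  · ring

open Classical in
/-- On a plane graph, a vertex model whose weights are invariant under complementation is a pair of
coupled Ising models on the vertices. -/
theorem exists_pos_vertexZ_eq [Fintype V] [Fintype E] (hG : G.IsPlanar) :
    ∃ c : ℝ, 0 < c ∧ ∀ w : E → ZMod 2 → ZMod 2 → ℝ,
      G.vertexZ (fun e x y _ => w e x y) = c * ∑ s : V → ZMod 2, ∑ s' : V → ZMod 2,
        ∏ e, (w e (edgeSum E (s ∘ G.tail) e) 0 + binarySign (edgeSum E (s' ∘ G.tail) e) *
          w e (edgeSum E (s ∘ G.tail) e) 1) := by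
  obtain ⟨c₁, hc₁, hface⟩ := G.exists_pos_sum_faces hG
  -- The road at a corner is the sum of the spins of its vertex and its face. The image of `f`
  -- consists of the even configurations, each hit equally often.
  let f : (V → ZMod 2) × (G.Face → ZMod 2) →+ (E × Bool → ZMod 2) := AddMonoidHom.mk'
    (fun y d => y.1 (G.tail d) + y.2 (G.leftFace d)) (by
      intro y z
      funext d
      simp only [Prod.fst_add, Prod.snd_add, Pi.add_apply]
      ring)
  obtain ⟨c₂, hc₂, hsum⟩ := exists_pos_sum_comp_hom f
  refine ⟨c₁ / c₂, by positivity, fun w => ?_⟩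
  have hcancel : ∀ a a' b b' : ZMod 2, a + b + (a' + b) = a + a' ∧ a + b + (a + b') = b + b' ∧
      a + b + (a + b') + (a' + b') + (a' + b) = 0 := by decide
  have hleft : ∀ e, G.leftFace (G.rot⁻¹ (e, false)) = G.leftFace (e, true) :=
    fun e => (G.leftFace_dartRev (e, false)).symm
  have hright : ∀ e, G.leftFace (G.rot⁻¹ (e, true)) = G.leftFace (e, false) :=
    fun e => (G.leftFace_dartRev (e, true)).symm
  have hf : ∀ y d, f y d = y.1 (G.tail d) + y.2 (G.leftFace d) := fun _ _ => rfl
  have hmem : ∀ r, r ∈ Set.range f ↔ ∀ e, G.EvenAt r e := by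
    intro r
    constructor
    · rintro ⟨y, rfl⟩ e
      simp only [EvenAt, hf, hleft, hright, G.tail_rot_inv]
      exact (hcancel _ _ _ _).2.2
    · intro h
      obtain ⟨s, t, hst⟩ := G.exists_vertex_face_of_even hG r (by
        funext e
        rw [edgeSum_apply, ← add_assoc]
        exact h e)
      exact ⟨(s, t), funext fun d => (hst d).symm⟩
  have h1 : ∑ y, ∏ e, w e (f y (e, false) + f y (G.rot⁻¹ (e, true)))
      (f y (e, false) + f y (G.rot⁻¹ (e, false))) = c₂ * G.vertexZ (fun e x y _ => w e x y) := by
    refine (hsum fun r => ∏ e, w e (r (e, false) + r (G.rot⁻¹ (e, true)))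
      (r (e, false) + r (G.rot⁻¹ (e, false)))).trans ?_
    congr 1
    refine Finset.sum_congr rfl fun r _ => ?_
    simp only [vertexWeight, Finset.prod_ite_zero, Finset.mem_univ, forall_true_left]
    by_cases h : ∀ e, G.EvenAt r e
    · rw [if_pos ((hmem r).2 h), if_pos h]
    · rw [if_neg fun h' => h ((hmem r).1 h'), if_neg h]
  rw [div_mul_eq_mul_div, eq_div_iff hc₂.ne', mul_comm, ← h1, Fintype.sum_prod_type, Finset.mul_sum]
  refine Finset.sum_congr rfl fun s _ => ?_
  -- For fixed vertex spins `s`, the face spins are dualized with edge weights that depend on `s`.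
  rw [← hface fun e a => w e (edgeSum E (s ∘ G.tail) e) a]
  refine Finset.sum_congr rfl fun t _ => Finset.prod_congr rfl fun e _ => ?_
  simp only [hf, hleft, hright, G.tail_rot_inv, edgeSum_apply, Function.comp_apply]
  rw [(hcancel _ _ _ 0).1, (hcancel _ 0 _ _).2.1]

end EmbeddedGraph

/-! ## The Ising model in the high-temperature form -/

/-- The Boltzmann weight of a spin configuration divided by the product of the hyperbolic cosines of
the couplings, `x` being the hyperbolic tangents of the couplings. -/
noncomputable def spinWeight {V E : Type*} [Fintype E] (tail : E × Bool → V) (x : E → ℝ)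
    (s : V → ZMod 2) : ℝ :=
  ∏ e, (1 + x e * binarySign (edgeSum E (s ∘ tail) e))

/-- Spins in multiplicative and in additive notation. -/
def unitsEquivZModTwo : ℤˣ ≃ ZMod 2 where
  toFun u := if u = 1 then 0 else 1
  invFun a := if a = 0 then 1 else -1
  left_inv := by decide
  right_inv := by decide

theorem binarySign_unitsEquivZModTwo (u : ℤˣ) :
    binarySign (unitsEquivZModTwo u) = ((u : ℤ) : ℝ) := by
  rcases Int.units_eq_one_or u with rfl | rfl
  · simp [unitsEquivZModTwo]
  · simp [unitsEquivZModTwo]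

theorem exp_mul_binarySign (K : ℝ) (a : ZMod 2) :
    Real.exp (K * binarySign a) = Real.cosh K * (1 + Real.tanh K * binarySign a) := by
  have h := (Real.cosh_pos K).ne'
  rw [Real.tanh_eq_sinh_div_cosh]
  rcases zmod_two_cases a with rfl | rfl
  · rw [binarySign_zero, mul_one, mul_one, ← Real.cosh_add_sinh]
    field_simp
  · rw [binarySign_one, mul_neg_one, mul_neg_one, ← Real.cosh_sub_sinh]
    field_simp
    ring

theorem isingWeight_eq {V E : Type*} [Fintype E] (tail : E × Bool → V) (K : E → ℝ)
    (s : V → ℤˣ) :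
    isingWeight tail K s = (∏ e, Real.cosh (K e)) *
      spinWeight tail (fun e => Real.tanh (K e)) (unitsEquivZModTwo ∘ s) := by
  rw [isingWeight, Real.exp_sum, spinWeight, ← Finset.prod_mul_distrib]
  refine Finset.prod_congr rfl fun e _ => ?_
  rw [← exp_mul_binarySign, edgeSum_apply, binarySign_add]
  simp only [Function.comp_apply, binarySign_unitsEquivZModTwo]

open Classical in
theorem isingTwoPoint_eq {V E : Type*} [Fintype V] [Fintype E] (tail : E × Bool → V) (K : E → ℝ)
    (e : E) :
    isingTwoPoint tail K (tail (e, false)) (tail (e, true)) =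
      (∑ s : V → ZMod 2, binarySign (edgeSum E (s ∘ tail) e) *
        spinWeight tail (fun e => Real.tanh (K e)) s) /
      ∑ s : V → ZMod 2, spinWeight tail (fun e => Real.tanh (K e)) s := by
  have hC : ∏ e, Real.cosh (K e) ≠ 0 :=
    Finset.prod_ne_zero_iff.2 fun e _ => (Real.cosh_pos (K e)).ne'
  unfold isingTwoPoint
  simp only [isingWeight_eq, mul_left_comm _ (∏ e, Real.cosh (K e)), ← Finset.mul_sum]
  rw [mul_div_mul_left _ _ hC]
  rw [← Equiv.sum_comp (Equiv.arrowCongr (Equiv.refl V) unitsEquivZModTwo),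
    ← Equiv.sum_comp (Equiv.arrowCongr (Equiv.refl V) unitsEquivZModTwo)]
  congr 1
  refine Finset.sum_congr rfl fun s _ => ?_
  rw [edgeSum_apply, binarySign_add]
  simp only [Function.comp_apply, Equiv.arrowCongr_apply, Equiv.refl_symm, Equiv.coe_refl, id,
    binarySign_unitsEquivZModTwo]
  rfl

theorem spinWeight_pos {V E : Type*} [Fintype E] (tail : E × Bool → V) {x : E → ℝ}
    (h0 : ∀ e, 0 ≤ x e) (h1 : ∀ e, x e < 1) (s : V → ZMod 2) : 0 < spinWeight tail x s := by
  refine Finset.prod_pos fun e _ => ?_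
  rcases zmod_two_cases (edgeSum E (s ∘ tail) e) with h | h
  · rw [h, binarySign_zero]
    linarith [h0 e]
  · rw [h, binarySign_one]
    linarith [h1 e]

/-! ### Decoupling into two Ising copies -/

/-- The local weights of the vertex model that comes from the Ising model. -/
noncomputable def isingQuadWeight (x : ℝ) (a b : ZMod 2) : ℝ :=
  if a = 0 then if b = 0 then 1 else 2 * x / (1 + x ^ 2)
  else if b = 0 then (1 - x ^ 2) / (1 + x ^ 2) else 0

/-- This is the decoupling identity: for `u = 0` the right side is the square of one Ising factor,
for `u = 1` it is (1+x)(1-x), each divided by 1 + x². -/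
theorem isingQuadWeight_expansion (x : ℝ) (u v : ZMod 2) :
    isingQuadWeight x u 0 + binarySign v * isingQuadWeight x u 1 =
      (1 + x ^ 2)⁻¹ * ((1 + x * binarySign v) * (1 + x * binarySign (v + u))) := by
  have h : (1 + x ^ 2) ≠ 0 := by positivity
  have h2 : (1 : ZMod 2) + 1 = 0 := rfl
  rcases zmod_two_cases u with rfl | rfl <;> rcases zmod_two_cases v with rfl | rfl <;>
    simp [isingQuadWeight, h2] <;> field_simp <;> ring

/-- The independence of `k` is the invariance under complementation, and rests on s² + c² = 1. -/
theorem quadWeight_eq_isingQuadWeight (x : ℝ) (a b k : ZMod 2) :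
    quadWeight (2 * x / (1 + x ^ 2)) (2 * x / (1 + x ^ 2)) ((1 - x ^ 2) / (1 + x ^ 2))
      ((1 - x ^ 2) / (1 + x ^ 2)) a b k = isingQuadWeight x a b := by
  have h : (1 + x ^ 2) ≠ 0 := by positivity
  unfold quadWeight isingQuadWeight
  split_ifs <;> try rfl
  field_simp
  ring

namespace EmbeddedGraph

variable {V E : Type*} (G : EmbeddedGraph V E)

theorem edgeSum_add_comp {A : Type*} (tail : E × Bool → A) (s s' : A → ZMod 2) (e : E) :
    edgeSum E ((s' + s) ∘ tail) e = edgeSum E (s' ∘ tail) e + edgeSum E (s ∘ tail) e := by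
  simp only [edgeSum_apply, Function.comp_apply, Pi.add_apply]
  ring

-- The modified weight at `e₀` is the one left by deleting a primal street and symmetrizing. Its
-- expansion is the unmodified one times s times the average of the two copies' spin products along
-- `e₀`; that average vanishes when they differ.
open Classical in
theorem exists_pos_ising_vertexZ_eq [Fintype V] [Fintype E] (hG : G.IsPlanar) (x : E → ℝ) :
    ∃ c : ℝ, 0 < c ∧
      G.vertexZ (fun e a b _ => isingQuadWeight (x e) a b) =
        c * (∑ s, spinWeight G.tail x s) ^ 2 ∧
      ∀ e₀, G.vertexZ (Function.update (fun e a b _ => isingQuadWeight (x e) a b) e₀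
          fun a b _ => if a = 0 then if b = 0 then (2 * x e₀ / (1 + x e₀ ^ 2)) ^ 2
            else 2 * x e₀ / (1 + x e₀ ^ 2) else 0) =
        2 * x e₀ / (1 + x e₀ ^ 2) * (c * ((∑ s, spinWeight G.tail x s) *
          ∑ s, binarySign (edgeSum E (s ∘ G.tail) e₀) * spinWeight G.tail x s)) := by
  obtain ⟨c, hc, h⟩ := G.exists_pos_vertexZ_eq hG
  have hD : 0 < ∏ e, (1 + x e ^ 2)⁻¹ := Finset.prod_pos fun e _ => by positivity
  -- For fixed `s'`, the shift from `s` to `s' + s` is a bijection, so the two copies become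
  -- independent.
  have hshift : ∀ (f g : (V → ZMod 2) → ℝ),
      ∑ s', ∑ s, f s' * g (s' + s) = (∑ s, f s) * ∑ s, g s := by
    intro f g
    rw [Finset.sum_mul_sum]
    refine Finset.sum_congr rfl fun s' _ => ?_
    rw [← Equiv.sum_comp (Equiv.addLeft s') fun s => f s' * g s]
    rfl
  refine ⟨c * ∏ e, (1 + x e ^ 2)⁻¹, by positivity, ?_, fun e₀ => ?_⟩
  · rw [h fun e a b => isingQuadWeight (x e) a b]
    simp only [isingQuadWeight_expansion, Finset.prod_mul_distrib, ← edgeSum_add_comp]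
    simp only [← Finset.mul_sum]
    rw [Finset.sum_comm]
    have hsq := hshift (spinWeight G.tail x) (spinWeight G.tail x)
    unfold spinWeight at hsq ⊢
    rw [hsq]
    ring
  · have hu : (Function.update (fun e a b _ => isingQuadWeight (x e) a b) e₀
          fun a b _ => if a = 0 then if b = 0 then (2 * x e₀ / (1 + x e₀ ^ 2)) ^ 2
            else 2 * x e₀ / (1 + x e₀ ^ 2) else 0 : E → ZMod 2 → ZMod 2 → ZMod 2 → ℝ) =
        fun e a b _ => Function.update (fun e a b => isingQuadWeight (x e) a b) e₀
          (fun a b => if a = 0 then if b = 0 then (2 * x e₀ / (1 + x e₀ ^ 2)) ^ 2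
            else 2 * x e₀ / (1 + x e₀ ^ 2) else 0) e a b := by
      funext e
      by_cases he : e = e₀
      · subst he
        simp
      · simp only [Function.update_of_ne he]
    have hprod : ∀ s s' : V → ZMod 2,
        ∏ e, (Function.update (fun e a b => isingQuadWeight (x e) a b) e₀
          (fun a b => if a = 0 then if b = 0 then (2 * x e₀ / (1 + x e₀ ^ 2)) ^ 2
            else 2 * x e₀ / (1 + x e₀ ^ 2) else 0) e (edgeSum E (s ∘ G.tail) e) 0 +
          binarySign (edgeSum E (s' ∘ G.tail) e) *
          Function.update (fun e a b => isingQuadWeight (x e) a b) e₀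
          (fun a b => if a = 0 then if b = 0 then (2 * x e₀ / (1 + x e₀ ^ 2)) ^ 2
            else 2 * x e₀ / (1 + x e₀ ^ 2) else 0) e (edgeSum E (s ∘ G.tail) e) 1) =
        (∏ e, (1 + x e ^ 2)⁻¹) * (x e₀ / (1 + x e₀ ^ 2)) *
          ((binarySign (edgeSum E (s' ∘ G.tail) e₀) * spinWeight G.tail x s') *
              spinWeight G.tail x (s' + s) +
            spinWeight G.tail x s' * (binarySign (edgeSum E ((s' + s) ∘ G.tail) e₀) *
              spinWeight G.tail x (s' + s))) := by
      intro s s'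
      have h1 : ∀ F : E → ℝ, ∏ e, F e = F e₀ * ∏ e ∈ Finset.univ.erase e₀, F e :=
        fun F => (Finset.mul_prod_erase _ _ (Finset.mem_univ e₀)).symm
      unfold spinWeight
      rw [h1, h1 fun e => (1 + x e ^ 2)⁻¹, h1 fun e => 1 + x e * binarySign (edgeSum E (s' ∘ G.tail) e),
        h1 fun e => 1 + x e * binarySign (edgeSum E ((s' + s) ∘ G.tail) e)]
      have h2 : ∏ e ∈ Finset.univ.erase e₀,
          (Function.update (fun e a b => isingQuadWeight (x e) a b) e₀
          (fun a b => if a = 0 then if b = 0 then (2 * x e₀ / (1 + x e₀ ^ 2)) ^ 2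
            else 2 * x e₀ / (1 + x e₀ ^ 2) else 0) e (edgeSum E (s ∘ G.tail) e) 0 +
          binarySign (edgeSum E (s' ∘ G.tail) e) *
          Function.update (fun e a b => isingQuadWeight (x e) a b) e₀
          (fun a b => if a = 0 then if b = 0 then (2 * x e₀ / (1 + x e₀ ^ 2)) ^ 2
            else 2 * x e₀ / (1 + x e₀ ^ 2) else 0) e (edgeSum E (s ∘ G.tail) e) 1) =
          (∏ e ∈ Finset.univ.erase e₀, (1 + x e ^ 2)⁻¹) * ((∏ e ∈ Finset.univ.erase e₀,
            (1 + x e * binarySign (edgeSum E (s' ∘ G.tail) e))) * ∏ e ∈ Finset.univ.erase e₀,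
              (1 + x e * binarySign (edgeSum E ((s' + s) ∘ G.tail) e))) := by
        simp only [← Finset.prod_mul_distrib]
        refine Finset.prod_congr rfl fun e he => ?_
        rw [Function.update_of_ne (Finset.ne_of_mem_erase he), isingQuadWeight_expansion,
          edgeSum_add_comp]
      rw [h2, Function.update_self, edgeSum_add_comp]
      have h3 : ∀ (u v : ZMod 2) (y : ℝ),
          (if u = 0 then if (0 : ZMod 2) = 0 then (2 * y / (1 + y ^ 2)) ^ 2
            else 2 * y / (1 + y ^ 2) else 0) + binarySign v *
          (if u = 0 then if (1 : ZMod 2) = 0 then (2 * y / (1 + y ^ 2)) ^ 2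
            else 2 * y / (1 + y ^ 2) else 0) =
          (1 + y ^ 2)⁻¹ * (y / (1 + y ^ 2)) * ((binarySign v + binarySign (v + u)) *
            ((1 + y * binarySign v) * (1 + y * binarySign (v + u)))) := by
        intro u v y
        have h : (1 + y ^ 2) ≠ 0 := by positivity
        have h2 : (1 : ZMod 2) + 1 = 0 := rfl
        rcases zmod_two_cases u with rfl | rfl <;> rcases zmod_two_cases v with rfl | rfl <;>
          simp [h2] <;> field_simp <;> ring
      rw [h3]
      ring
    rw [hu, h]
    simp only [hprod, ← Finset.mul_sum]
    rw [Finset.sum_comm]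
    simp only [Finset.sum_add_distrib]
    rw [hshift (fun s => binarySign (edgeSum E (s ∘ G.tail) e₀) * spinWeight G.tail x s)
        (spinWeight G.tail x),
      hshift (spinWeight G.tail x)
        (fun s => binarySign (edgeSum E (s ∘ G.tail) e₀) * spinWeight G.tail x s)]
    ring

end EmbeddedGraph

/-! ### Deleting a street or a road -/

theorem isingQuadWeight_sq_add_sq (x : ℝ) :
    (2 * x / (1 + x ^ 2)) ^ 2 + ((1 - x ^ 2) / (1 + x ^ 2)) ^ 2 = 1 := by
  have hD : (1 + x ^ 2) ≠ 0 := by positivity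
  field_simp
  ring

namespace EmbeddedGraph

variable {V E : Type*} (G : EmbeddedGraph V E)

theorem dimerZ_cgWeight [Fintype E] (x : E → ℝ) :
    dimerZ G.cgEnds (cgWeight x) = G.vertexZ fun e a b _ => isingQuadWeight (x e) a b := by
  rw [dimerZ_eq_sum_roads]
  refine Finset.sum_congr rfl fun r _ => ?_
  simp only [cgWeight, ite_self, Finset.prod_const_one, one_mul, vertexWeight,
    quadWeight_eq_isingQuadWeight]

open Classical in
theorem two_mul_dimerZ_sub_primalStreet [Fintype E] (x : E → ℝ) (d : E × Bool) :
    2 * (dimerZ G.cgEnds (cgWeight x) -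
        dimerZ G.cgEnds (Function.update (cgWeight x) (.primalStreet d) 0)) =
      G.vertexZ (Function.update (fun e a b _ => isingQuadWeight (x e) a b) d.1
        fun a b _ => if a = 0 then if b = 0 then (2 * x d.1 / (1 + x d.1 ^ 2)) ^ 2
          else 2 * x d.1 / (1 + x d.1 ^ 2) else 0) := by
  set s := 2 * x d.1 / (1 + x d.1 ^ 2) with hs
  set c := (1 - x d.1 ^ 2) / (1 + x d.1 ^ 2) with hc
  -- The Boolean `d.2` selects which of the two parallel streets gets weight 0.
  have hZ : dimerZ G.cgEnds (Function.update (cgWeight x) (.primalStreet d) 0) =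
      G.vertexZ (Function.update (fun e a b _ => isingQuadWeight (x e) a b) d.1
        (quadWeight (if d.2 then s else 0) (if d.2 then 0 else s) c c)) := by
    rw [dimerZ_eq_sum_roads]
    refine Finset.sum_congr rfl fun r _ => ?_
    simp only [Function.update_of_ne (a := CGEdge.road _) (a' := CGEdge.primalStreet d)
      (by simp), cgWeight, ite_self, Finset.prod_const_one, one_mul]
    refine Finset.prod_congr rfl fun e _ => ?_
    obtain ⟨e₀, k⟩ := d
    by_cases he : e = e₀
    · subst he
      rw [Function.update_self]
      cases k <;> simp [cgWeight, hs, hc]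
    · rw [Function.update_of_ne he]
      simp [cgWeight, he, vertexWeight, quadWeight_eq_isingQuadWeight]
  rw [dimerZ_cgWeight, hZ]
  refine G.two_mul_vertexZ_sub_update _ (fun _ _ _ _ => rfl) _ _ _ fun a b k => ?_
  simp only [← quadWeight_eq_isingQuadWeight _ _ _ k, ← hs, ← hc]
  have h2 : (1 : ZMod 2) + 1 = 0 := rfl
  have hsc : s ^ 2 + c ^ 2 = 1 := isingQuadWeight_sq_add_sq (x d.1)
  rcases zmod_two_cases a with rfl | rfl <;> rcases zmod_two_cases b with rfl | rfl <;>
    rcases zmod_two_cases k with rfl | rfl <;> cases d.2 <;> simp [quadWeight, h2] <;> linarith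

open Classical in
theorem two_mul_dimerZ_sub_dualStreet [Fintype E] (x : E → ℝ) (d : E × Bool) :
    2 * (dimerZ G.cgEnds (cgWeight x) -
        dimerZ G.cgEnds (Function.update (cgWeight x) (.dualStreet d) 0)) =
      G.vertexZ (Function.update (fun e a b _ => isingQuadWeight (x e) a b) d.1
        fun a b _ => if b = 0 then if a = 0 then ((1 - x d.1 ^ 2) / (1 + x d.1 ^ 2)) ^ 2
          else (1 - x d.1 ^ 2) / (1 + x d.1 ^ 2) else 0) := by
  set s := 2 * x d.1 / (1 + x d.1 ^ 2) with hs
  set c := (1 - x d.1 ^ 2) / (1 + x d.1 ^ 2) with hc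
  have hZ : dimerZ G.cgEnds (Function.update (cgWeight x) (.dualStreet d) 0) =
      G.vertexZ (Function.update (fun e a b _ => isingQuadWeight (x e) a b) d.1
        (quadWeight s s (if d.2 then c else 0) (if d.2 then 0 else c))) := by
    rw [dimerZ_eq_sum_roads]
    refine Finset.sum_congr rfl fun r _ => ?_
    simp only [Function.update_of_ne (a := CGEdge.road _) (a' := CGEdge.dualStreet d)
      (by simp), cgWeight, ite_self, Finset.prod_const_one, one_mul]
    refine Finset.prod_congr rfl fun e _ => ?_
    obtain ⟨e₀, k⟩ := d
    by_cases he : e = e₀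
    · subst he
      rw [Function.update_self]
      cases k <;> simp [cgWeight, hs, hc]
    · rw [Function.update_of_ne he]
      simp [cgWeight, he, vertexWeight, quadWeight_eq_isingQuadWeight]
  rw [dimerZ_cgWeight, hZ]
  refine G.two_mul_vertexZ_sub_update _ (fun _ _ _ _ => rfl) _ _ _ fun a b k => ?_
  simp only [← quadWeight_eq_isingQuadWeight _ _ _ k, ← hs, ← hc]
  have h2 : (1 : ZMod 2) + 1 = 0 := rfl
  have hsc : s ^ 2 + c ^ 2 = 1 := isingQuadWeight_sq_add_sq (x d.1)
  rcases zmod_two_cases a with rfl | rfl <;> rcases zmod_two_cases b with rfl | rfl <;>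
    rcases zmod_two_cases k with rfl | rfl <;> cases d.2 <;> simp [quadWeight, h2] <;> linarith

-- Complementing all roads preserves the weight and exchanges the configurations with and without
-- the given road.
open Classical in
theorem two_mul_dimerZ_sub_road [Fintype E] (x : E → ℝ) (d : E × Bool) :
    2 * (dimerZ G.cgEnds (cgWeight x) -
        dimerZ G.cgEnds (Function.update (cgWeight x) (.road d) 0)) = dimerZ G.cgEnds (cgWeight x) := by
  have hZ : dimerZ G.cgEnds (Function.update (cgWeight x) (.road d) 0) =
      ∑ r : E × Bool → ZMod 2, (if r d = 0 then (1 : ℝ) else 0) *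
        ∏ e, G.vertexWeight (fun a b _ => isingQuadWeight (x e) a b) r e := by
    rw [dimerZ_eq_sum_roads]
    refine Finset.sum_congr rfl fun r _ => ?_
    have h1 : ∏ d', (if r d' = 1 then Function.update (cgWeight x) (.road d) 0 (.road d') else 1) =
        if r d = 0 then (1 : ℝ) else 0 := by
      rcases zmod_two_cases (r d) with h | h
      · rw [if_pos h]
        refine Finset.prod_eq_one fun d' _ => ?_
        split_ifs with h'
        · have hne : d' ≠ d := by
            rintro rfl
            simp [h] at h'
          simp [hne, cgWeight]
        · rfl
      · rw [if_neg (by simp [h])]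
        exact Finset.prod_eq_zero (Finset.mem_univ d) (by simp [h])
    rw [h1]
    congr 1
    refine Finset.prod_congr rfl fun e _ => ?_
    simp [cgWeight, vertexWeight, quadWeight_eq_isingQuadWeight]
  have hflip : ∑ r : E × Bool → ZMod 2, (if r d = 0 then (1 : ℝ) else 0) *
        ∏ e, G.vertexWeight (fun a b _ => isingQuadWeight (x e) a b) r e =
      ∑ r : E × Bool → ZMod 2, (if r d = 0 then 0 else (1 : ℝ)) *
        ∏ e, G.vertexWeight (fun a b _ => isingQuadWeight (x e) a b) r e := by
    rw [← Equiv.sum_comp (Equiv.addRight (1 : E × Bool → ZMod 2)) fun r =>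
      (if r d = 0 then (1 : ℝ) else 0) *
        ∏ e, G.vertexWeight (fun a b _ => isingQuadWeight (x e) a b) r e]
    refine Finset.sum_congr rfl fun r _ => ?_
    have h2 : (1 : ZMod 2) + 1 = 0 := rfl
    simp only [Equiv.coe_addRight, vertexWeight_add_one, Pi.add_apply, Pi.one_apply]
    rcases zmod_two_cases (r d) with h | h <;> simp [h, h2]
  have hadd : dimerZ G.cgEnds (cgWeight x) =
      dimerZ G.cgEnds (Function.update (cgWeight x) (.road d) 0) +
        dimerZ G.cgEnds (Function.update (cgWeight x) (.road d) 0) := by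
    rw [hZ]
    nth_rewrite 2 [hflip]
    rw [dimerZ_cgWeight, vertexZ, ← Finset.sum_add_distrib]
    refine Finset.sum_congr rfl fun r _ => ?_
    split_ifs <;> ring
  linarith

-- This is the total probability at a white vertex, read off locally: the symmetrized weights of the
-- two streets add up to the full weight at the edge, by s² + c² = 1 when neither spin changes.
open Classical in
theorem dimerZ_sub_primalStreet_add_dualStreet [Fintype E] (x : E → ℝ) (d : E × Bool) :
    2 * (dimerZ G.cgEnds (cgWeight x) -
        dimerZ G.cgEnds (Function.update (cgWeight x) (.primalStreet d) 0)) +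
      2 * (dimerZ G.cgEnds (cgWeight x) -
        dimerZ G.cgEnds (Function.update (cgWeight x) (.dualStreet d) 0)) = dimerZ G.cgEnds (cgWeight x) := by
  have h := G.vertexZ_update (fun e a b _ => isingQuadWeight (x e) a b) d.1
    (fun a b _ => isingQuadWeight (x d.1) a b)
  rw [Function.update_eq_self d.1 fun e a b _ => isingQuadWeight (x e) a b] at h
  rw [two_mul_dimerZ_sub_primalStreet, two_mul_dimerZ_sub_dualStreet, dimerZ_cgWeight, h,
    vertexZ_update, vertexZ_update, ← Finset.sum_add_distrib]
  refine Finset.sum_congr rfl fun r _ => ?_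
  rw [← add_mul]
  congr 1
  unfold vertexWeight
  by_cases he : G.EvenAt r d.1
  · simp only [if_pos he, isingQuadWeight]
    split_ifs
    · exact isingQuadWeight_sq_add_sq (x d.1)
    all_goals ring
  · simp only [if_neg he, add_zero]

open Classical in
/-- The Kramers-Wannier relation between the nearest-neighbour correlations of dual Ising models. -/
theorem isingTwoPoint_dual [Fintype V] [Fintype E] (hG : G.IsPlanar) (K : E → ℝ)
    (hK : ∀ e, 0 < K e) (e : E) :
    (1 - Real.tanh (K e) ^ 2) * isingTwoPoint G.leftFace (fun e => dualCoupling (K e))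
        (G.leftFace (e, false)) (G.leftFace (e, true)) =
      1 + Real.tanh (K e) ^ 2 - 2 * Real.tanh (K e) * isingTwoPoint G.tail K
        (G.tail (e, false)) (G.tail (e, true)) := by
  set x : E → ℝ := fun e => Real.tanh (K e) with hx
  have hx0 : ∀ e, 0 < x e := fun e => by
    simp only [hx, Real.tanh_eq_sinh_div_cosh]
    exact div_pos (Real.sinh_pos_iff.2 (hK e)) (Real.cosh_pos _)
  have hx1 : ∀ e, x e < 1 := fun e => Real.tanh_lt_one _
  have hdual : (fun e => Real.tanh (dualCoupling (K e))) = fun e => (1 - x e) / (1 + x e) := by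
    funext e
    have h0 := hx0 e
    have h1 := hx1 e
    refine Real.tanh_artanh ⟨?_, ?_⟩
    · refine lt_of_lt_of_le neg_one_lt_zero (div_nonneg ?_ ?_) <;> linarith
    · rw [div_lt_one] <;> linarith
  obtain ⟨c, hc, hface⟩ := G.exists_pos_sum_faces hG
  have hD : 0 < ∏ e, 2 / (1 + x e) := Finset.prod_pos fun e _ => by
    have := hx0 e
    positivity
  have hH : 0 < ∑ s, spinWeight G.tail x s :=
    Finset.sum_pos (fun s _ => spinWeight_pos G.tail (fun e => (hx0 e).le) hx1 s)
      Finset.univ_nonempty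
  have hZ : ∑ t, spinWeight G.leftFace (fun e => (1 - x e) / (1 + x e)) t =
      c * ((∏ e, 2 / (1 + x e)) * ∑ s, spinWeight G.tail x s) := by
    refine (hface fun e a => 1 + (1 - x e) / (1 + x e) * binarySign a).trans ?_
    congr 1
    rw [Finset.mul_sum]
    refine Finset.sum_congr rfl fun s _ => ?_
    rw [spinWeight, ← Finset.prod_mul_distrib]
    refine Finset.prod_congr rfl fun e _ => ?_
    have h : 1 + x e ≠ 0 := by linarith [hx0 e]
    rw [binarySign_zero, binarySign_one]
    field_simp
    ring
  -- The sign inserted at `e` turns the dual factor 1 + xσ into 1 - xσ, and (1-xσ)/(1+xσ) =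
  -- (1+x²-2xσ)/(1-x²) for σ = ±1.
  have hN : ∑ t, binarySign (edgeSum E (t ∘ G.leftFace) e) *
        spinWeight G.leftFace (fun e => (1 - x e) / (1 + x e)) t =
      c * ((∏ e, 2 / (1 + x e)) * ∑ s, (1 + x e ^ 2 - 2 * x e *
        binarySign (edgeSum E (s ∘ G.tail) e)) / (1 - x e ^ 2) * spinWeight G.tail x s) := by
    have h1 : ∀ t, binarySign (edgeSum E (t ∘ G.leftFace) e) *
        spinWeight G.leftFace (fun e => (1 - x e) / (1 + x e)) t =
        ∏ e', (if e' = e then binarySign (edgeSum E (t ∘ G.leftFace) e') else 1) *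
          (1 + (1 - x e') / (1 + x e') * binarySign (edgeSum E (t ∘ G.leftFace) e')) := by
      intro t
      rw [Finset.prod_mul_distrib, Finset.prod_ite_eq', if_pos (Finset.mem_univ _), spinWeight]
    simp only [h1]
    refine (hface fun e' a => (if e' = e then binarySign a else 1) *
      (1 + (1 - x e') / (1 + x e') * binarySign a)).trans ?_
    congr 1
    rw [Finset.mul_sum]
    refine Finset.sum_congr rfl fun s _ => ?_
    have h2 : (1 + x e ^ 2 - 2 * x e * binarySign (edgeSum E (s ∘ G.tail) e)) / (1 - x e ^ 2) =
        ∏ e', if e' = e then (1 + x e' ^ 2 - 2 * x e' *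
          binarySign (edgeSum E (s ∘ G.tail) e')) / (1 - x e' ^ 2) else 1 := by
      rw [Finset.prod_ite_eq', if_pos (Finset.mem_univ _)]
    rw [h2, spinWeight, ← Finset.prod_mul_distrib, ← Finset.prod_mul_distrib]
    refine Finset.prod_congr rfl fun e' _ => ?_
    have h : 1 + x e' ≠ 0 := by linarith [hx0 e']
    have h' : 1 - x e' ^ 2 ≠ 0 := by nlinarith [hx0 e', hx1 e']
    rw [binarySign_zero, binarySign_one]
    split_ifs
    · rcases zmod_two_cases (edgeSum E (s ∘ G.tail) e') with hs | hs <;>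
        simp only [hs, binarySign_zero, binarySign_one] <;> field_simp <;> ring
    · field_simp
      ring
  have h' : 1 - x e ^ 2 ≠ 0 := by nlinarith [hx0 e, hx1 e]
  have hsplit : (1 - x e ^ 2) * ∑ s, (1 + x e ^ 2 - 2 * x e *
        binarySign (edgeSum E (s ∘ G.tail) e)) / (1 - x e ^ 2) * spinWeight G.tail x s =
      (1 + x e ^ 2) * ∑ s, spinWeight G.tail x s -
        2 * x e * ∑ s, binarySign (edgeSum E (s ∘ G.tail) e) * spinWeight G.tail x s := by
    simp only [Finset.mul_sum, ← Finset.sum_sub_distrib]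
    refine Finset.sum_congr rfl fun s _ => ?_
    field_simp
  rw [isingTwoPoint_eq, isingTwoPoint_eq, hdual, hZ, hN, mul_div_mul_left _ _ hc.ne',
    mul_div_mul_left _ _ hD.ne', ← mul_div_assoc]
  change (1 - x e ^ 2) * _ / _ = 1 + x e ^ 2 - 2 * x e *
    ((∑ s, binarySign (edgeSum E (s ∘ G.tail) e) * spinWeight G.tail x s) /
      ∑ s, spinWeight G.tail x s)
  rw [hsplit]
  field_simp

end EmbeddedGraph

/-! ### The edge probabilities -/

theorem lemma2p6 {V E : Type*} [Fintype V] [Fintype E]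
    (G : EmbeddedGraph V E) (hG : G.IsPlanar)
    (β : ℝ) (hβ : 0 ≤ β) (J : E → ℝ) (hJ : ∀ e, 0 ≤ J e) :
    (∀ d : E × Bool, G.cgProb β J (.road d) = 1 / 2) ∧
    (∀ e : E,
      G.cgProb β J (.primalStreet (e, false)) = G.cgProb β J (.primalStreet (e, true)) ∧
      G.cgProb β J (.dualStreet (e, false)) = G.cgProb β J (.dualStreet (e, true))) ∧
    (∀ d : E × Bool,
      G.cgProb β J (.primalStreet d) =
        Real.tanh (β * J d.1) / (1 + Real.tanh (β * J d.1) ^ 2) *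
          isingTwoPoint G.tail (fun e => β * J e)
            (G.tail (d.1, false)) (G.tail (d.1, true))) ∧
    ((∀ e, 0 < β * J e) → ∀ d : E × Bool,
      G.cgProb β J (.dualStreet d) =
        (1 - Real.tanh (β * J d.1) ^ 2) / (2 * (1 + Real.tanh (β * J d.1) ^ 2)) *
          isingTwoPoint G.leftFace (fun e => dualCoupling (β * J e))
            (G.leftFace (d.1, false)) (G.leftFace (d.1, true))) := by
  classical
  set x : E → ℝ := fun e => Real.tanh (β * J e) with hx
  have hx0 : ∀ e, 0 ≤ x e := fun e => by
    rw [hx]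
    simp only [Real.tanh_eq_sinh_div_cosh]
    exact div_nonneg (Real.sinh_nonneg_iff.2 (mul_nonneg hβ (hJ e))) (Real.cosh_pos _).le
  have hx1 : ∀ e, x e < 1 := fun e => Real.tanh_lt_one _
  obtain ⟨c, hc, hZ, hP⟩ := G.exists_pos_ising_vertexZ_eq hG x
  have hH : 0 < ∑ s, spinWeight G.tail x s :=
    Finset.sum_pos (fun s _ => spinWeight_pos G.tail hx0 hx1 s) Finset.univ_nonempty
  rw [← G.dimerZ_cgWeight] at hZ
  have hZpos : 0 < dimerZ G.cgEnds (cgWeight x) := by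
    rw [hZ]
    positivity
  have hprimal : ∀ d : E × Bool, G.cgProb β J (.primalStreet d) =
      x d.1 / (1 + x d.1 ^ 2) * isingTwoPoint G.tail (fun e => β * J e)
        (G.tail (d.1, false)) (G.tail (d.1, true)) := by
    intro d
    have h := (G.two_mul_dimerZ_sub_primalStreet x d).trans (hP d.1)
    have hD : (1 + x d.1 ^ 2) ≠ 0 := by positivity
    rw [isingTwoPoint_eq]
    simp only [EmbeddedGraph.cgProb, dimerProb_eq]
    rw [div_eq_iff hZpos.ne']
    rw [← hx]
    rw [hZ] at h ⊢
    field_simp at h ⊢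
    linarith
  have hsum : ∀ d : E × Bool,
      G.cgProb β J (.primalStreet d) + G.cgProb β J (.dualStreet d) = 1 / 2 := by
    intro d
    have h := G.dimerZ_sub_primalStreet_add_dualStreet x d
    simp only [EmbeddedGraph.cgProb, dimerProb_eq]
    rw [← add_div, div_eq_iff hZpos.ne']
    linarith
  refine ⟨fun d => ?_, fun e => ?_, hprimal, fun hpos d => ?_⟩
  · have h := G.two_mul_dimerZ_sub_road x d
    simp only [EmbeddedGraph.cgProb, dimerProb_eq]
    rw [div_eq_iff hZpos.ne']
    linarith
  · have h : G.cgProb β J (.primalStreet (e, false)) = G.cgProb β J (.primalStreet (e, true)) :=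
      (hprimal (e, false)).trans (hprimal (e, true)).symm
    refine ⟨h, ?_⟩
    -- Equality for dual streets follows from that for primal ones, since both sums are 1/2.
    linarith [hsum (e, false), hsum (e, true)]
  · have hD : (1 + x d.1 ^ 2) ≠ 0 := by positivity
    have h := G.isingTwoPoint_dual hG (fun e => β * J e) hpos d.1
    have h' : G.cgProb β J (.dualStreet d) = 1 / 2 - G.cgProb β J (.primalStreet d) := by
      linarith [hsum d]
    rw [h', hprimal]
    change (1 - x d.1 ^ 2) * _ = 1 + x d.1 ^ 2 - 2 * x d.1 * _ at h
    change _ = (1 - x d.1 ^ 2) / (2 * (1 + x d.1 ^ 2)) * _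
    field_simp
    linarith
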